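/- Let $K$ be a field of characteristic zero, $V$ a $K$-vector space of finite dimension $r\ge 1$, $U=V^*$, and let $X=(x_1,\dots,x_N)$ be a finite sequence of elements of $U$ that spans $U$. Subsequences $A\subseteq X$ are given by subsets of the index set $\{1,\dots,N\}$. The rank $\operatorname{rk}A$ is the maximal number of linearly independent elements of $A$, the closure is $\operatorname{clos}(A)=\{x\in X:\operatorname{rk}(A\cup x)=\operatorname{rk}A\}$, and $C$ is a flat if $C=\operatorname{clos}(C)$. Let $\mathcal L(X)$ be the set of flats ordered by inclusion. For a non-empty upper set $J\subseteq\mathcal L(X)$ put $\chi_J(A)=1$ if $\operatorname{clos}(A)\in J$ and $\chi_J(A)=0$ otherwise. For $Y\subseteq X$ let $p_Y=\prod_{x\in Y}x\in\operatorname{Sym}(U)$. Define $$\mathcal P(X,0,J)=\operatorname{span}\{p_Y: Y\subseteq X,\ \operatorname{clos}(X\setminus Y)\in J\},$$ $$\mathcal P(X,1,J)=\operatorname{span}\{f\,p_Y: Y\subseteq X,\ f\in\operatorname{Sym}(U),\ 0\le \deg f\le \chi_J(X\setminus Y)\}.$$ These are graded subspaces of $\operatorname{Sym}(U)$; for a graded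 subspace $P=\bigoplus_i P_i$ let $\operatorname{Hilb}(P,t)=\sum_{i\ge0}\dim(P_i)\,t^i$. Let $T_X(x,y)=\sum_{A\subseteq X}(x-1)^{r-\operatorname{rk}A}(y-1)^{|A|-\operatorname{rk}A}$ be the Tutte polynomial. **Theorem.** For every non-empty upper set $J\subseteq\mathcal L(X)$, $$\operatorname{Hilb}(\mathcal P(X,0,J),t)=t^{N-r}\sum_{\substack{A\subseteq X\\ \operatorname{clos}(A)\in J}}t^{\,r-\operatorname{rk}A}\Bigl(\frac1t-1\Bigr)^{|A|-\operatorname{rk}A}$$ as formal Laurent series in $t$. This interpolates between the Tutte evaluations for the central space $\mathcal P(X,0,\{X\})$ and the external space $\mathcal P(X,1,\{X\})$, namely $$\operatorname{Hilb}(\mathcal P(X,0,\{X\}),t)=t^{N-r}\,T_X\Bigl(1,\frac1t\Bigr),\qquad \operatorname{Hilb}(\mathcal P(X,0,\mathcal L(X)),t)=\operatorname{Hilb}(\mathcal P(X,1,\{X\}),t)=t^{N-r}\,T_X\Bigl(1+t,\frac1t\Bigr).$$ -/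

import Mathlib

namespace Zonotopal

section Matroid

variable {K U : Type*} [Field K] [AddCommGroup U] [Module K U] {N : ℕ}

/-- Subsequences of `X = (x_1, …, x_N)` are encoded by their index sets `A : Finset (Fin N)`.
The rank of a subsequence is the maximal number of linearly independent members, that is,
the dimension of its span. -/
noncomputable def rank (X : Fin N → U) (A : Finset (Fin N)) : ℕ :=
  Set.finrank K (X '' (A : Set (Fin N)))

variable (K) in
open Classical in
/-- The closure `{x ∈ X : rank (A ∪ x) = rank A}` of a subsequence. -/
noncomputable def clos (X : Fin N → U) (A : Finset (Fin N)) : Finset (Fin N) :=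
  Finset.univ.filter fun i => rank (K := K) X (insert i A) = rank (K := K) X A

theorem mem_clos_iff (X : Fin N → U) (A : Finset (Fin N)) (i : Fin N) :
    i ∈ clos K X A ↔ X i ∈ Submodule.span K (X '' (A : Set (Fin N))) := by
  classical
  have hfin : (X '' ((insert i A : Finset (Fin N)) : Set (Fin N))).Finite := Set.toFinite _
  have hle : Submodule.span K (X '' (A : Set (Fin N))) ≤
      Submodule.span K (X '' ((insert i A : Finset (Fin N)) : Set (Fin N))) :=
    Submodule.span_mono (Set.image_mono (by simp))
  rw [clos, Finset.mem_filter]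
  simp only [Finset.mem_univ, true_and, rank, Set.finrank]
  constructor
  · intro h
    have : FiniteDimensional K
        (Submodule.span K (X '' ((insert i A : Finset (Fin N)) : Set (Fin N)))) :=
      FiniteDimensional.span_of_finite K hfin
    rw [Submodule.eq_of_le_of_finrank_eq hle h.symm]
    exact Submodule.subset_span ⟨i, by simp, rfl⟩
  · intro h
    suffices hs : Submodule.span K (X '' ((insert i A : Finset (Fin N)) : Set (Fin N))) =
        Submodule.span K (X '' (A : Set (Fin N))) by rw [hs]
    refine le_antisymm ?_ hle
    rw [Submodule.span_le]
    rintro _ ⟨j, hj, rfl⟩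
    rcases Finset.mem_insert.1 (Finset.mem_coe.1 hj) with rfl | hj
    · exact h
    · exact Submodule.subset_span ⟨j, hj, rfl⟩

theorem clos_clos (X : Fin N → U) (A : Finset (Fin N)) :
    clos K X (clos K X A) = clos K X A := by
  ext i
  rw [mem_clos_iff, mem_clos_iff X A]
  have h : Submodule.span K (X '' (clos K X A : Set (Fin N))) =
      Submodule.span K (X '' (A : Set (Fin N))) := by
    apply le_antisymm
    · rw [Submodule.span_le]
      rintro _ ⟨j, hj, rfl⟩
      exact (mem_clos_iff X A j).1 hj
    · refine Submodule.span_mono (Set.image_mono fun j hj => ?_)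
      exact (mem_clos_iff X A j).2 (Submodule.subset_span ⟨j, hj, rfl⟩)
  rw [h]

variable (K) in
/-- The lattice of flats, ordered by inclusion. -/
abbrev Flat (X : Fin N → U) : Type := {C : Finset (Fin N) // clos K X C = C}

variable (K) in
/-- The flat spanned by a subsequence. -/
noncomputable def closFlat (X : Fin N → U) (A : Finset (Fin N)) : Flat K X :=
  ⟨clos K X A, clos_clos X A⟩

variable (K) in
/-- The whole sequence, as a flat. -/
noncomputable def topFlat (X : Fin N → U) : Flat K X :=
  ⟨Finset.univ, Finset.eq_univ_of_forall fun i =>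
    (mem_clos_iff X _ i).2 (Submodule.subset_span ⟨i, by simp, rfl⟩)⟩

open Classical in
/-- The indicator function `χ` of an upper set `J` of flats, extended to all subsequences
by `χ A = χ (clos A)`. -/
noncomputable def chi {X : Fin N → U} (J : UpperSet (Flat K X)) (A : Finset (Fin N)) : ℕ :=
  if closFlat K X A ∈ J then 1 else 0

variable (K) in
/-- The Tutte polynomial `∑_A (x - 1)^(r - rank A) (y - 1)^(|A| - rank A)` of the matroid of `X`,
where `r` is the rank of `X`; the variables `x`, `y` have the indices `0`, `1`.
Since `rank A ≤ r` and `rank A ≤ |A|`, no subtraction is truncated. -/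
noncomputable def tuttePolynomial (X : Fin N → U) : MvPolynomial (Fin 2) ℤ :=
  ∑ A : Finset (Fin N),
    (MvPolynomial.X 0 - 1) ^ (rank (K := K) X Finset.univ - rank (K := K) X A) *
      (MvPolynomial.X 1 - 1) ^ (A.card - rank (K := K) X A)

end Matroid

section PSpace

variable {K U : Type*} [Field K] [AddCommGroup U] [Module K U] {N : ℕ}

variable (K U) in
/-- The degree `i` component of the symmetric algebra: the span of all products of `i`
elements of `U`. -/
noncomputable def symComponent (i : ℕ) : Submodule K (SymmetricAlgebra K U) :=
  LinearMap.range (SymmetricAlgebra.ι K U) ^ i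

variable (K) in
/-- `p_Y`, the product of the members of the subsequence `Y` in the symmetric algebra. -/
noncomputable def pProd (X : Fin N → U) (Y : Finset (Fin N)) : SymmetricAlgebra K U :=
  ∏ i ∈ Y, SymmetricAlgebra.ι K U (X i)

/-- The generating set `S(X,k,J)` for `k ≥ 0`. For `k = 0` it consists of the `p_Y` with
`clos (X \ Y) ∈ J`; for `k ≥ 1` it consists of the `f p_Y` with `deg f ≤ χ(X \ Y) + k - 1`. -/
def generators {X : Fin N → U} (J : UpperSet (Flat K X)) : ℕ → Set (SymmetricAlgebra K U)
  | 0 => {q | ∃ Y : Finset (Fin N), closFlat K X Yᶜ ∈ J ∧ q = pProd K X Y}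
  | k + 1 => {q | ∃ (Y : Finset (Fin N)) (f : SymmetricAlgebra K U),
      f ∈ (⨆ i ∈ Finset.range (chi J Yᶜ + k + 1), symComponent K U i) ∧ q = f * pProd K X Y}

/-- The hierarchical zonotopal space `P(X,k,J)`, for `k ≥ 0`. -/
def PSpace {X : Fin N → U} (k : ℕ) (J : UpperSet (Flat K X)) :
    Submodule K (SymmetricAlgebra K U) :=
  Submodule.span K (generators J k)

/-- The Hilbert series `∑ dim (P_i) t^i` of a graded subspace `P` of the symmetric algebra,
where `P_i` is the intersection of `P` with the degree `i` component. -/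
noncomputable def hilbertSeries (P : Submodule K (SymmetricAlgebra K U)) : PowerSeries ℚ :=
  PowerSeries.mk fun i => (Module.finrank K (P ⊓ symComponent K U i : Submodule K _) : ℚ)

theorem pProd_mem (X : Fin N → U) (Y : Finset (Fin N)) :
    pProd K X Y ∈ symComponent K U Y.card := by
  classical
  induction Y using Finset.induction_on with
  | empty => simp [pProd, symComponent, Submodule.one_le.1]
  | insert a s ha ih =>
    rw [pProd, Finset.prod_insert ha, Finset.card_insert_of_notMem ha, symComponent, pow_succ']
    exact Submodule.mul_mem_mul ⟨X a, rfl⟩ ih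

/-- The spaces `P(X,k,J)` are graded subspaces of the symmetric algebra. -/
theorem PSpace_eq_iSup {X : Fin N → U} (k : ℕ) (J : UpperSet (Flat K X)) :
    PSpace k J = ⨆ i, PSpace k J ⊓ symComponent K U i := by
  refine le_antisymm ?_ (iSup_le fun i => inf_le_left)
  conv_lhs => rw [PSpace]
  rw [Submodule.span_le]
  cases k with
  | zero =>
    rintro _ ⟨Y, hY, rfl⟩
    exact Submodule.mem_iSup_of_mem Y.card
      ⟨Submodule.subset_span ⟨Y, hY, rfl⟩, pProd_mem X Y⟩
  | succ k =>
    rintro _ ⟨Y, f, hf, rfl⟩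
    have key : (⨆ i ∈ Finset.range (chi J Yᶜ + k + 1), symComponent K U i) ≤
        (⨆ i, PSpace (k + 1) J ⊓ symComponent K U i).comap
          (LinearMap.mulRight K (pProd K X Y)) := by
      refine iSup₂_le fun i hi g hg => ?_
      refine Submodule.mem_iSup_of_mem (i + Y.card) ⟨Submodule.subset_span ⟨Y, g, ?_, rfl⟩, ?_⟩
      · exact Submodule.mem_iSup_of_mem i (Submodule.mem_iSup_of_mem hi hg)
      · change g * pProd K X Y ∈ _
        rw [symComponent, pow_add]
        exact Submodule.mul_mem_mul hg (pProd_mem X Y)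
    exact key hf

end PSpace

/-- The variable `t`, in the field of formal Laurent series over `ℚ`. -/
noncomputable def t : LaurentSeries ℚ := ((PowerSeries.X : PowerSeries ℚ) : LaurentSeries ℚ)

end Zonotopal

namespace Zonotopal

/-! ### Splitting subsets by the last index. -/

section Combinatorics

/-! The products p of complements of the reduced sets A with clos(A) in J form a basis of P(X,0,J),
and each is homogeneous of degree N - |A|. They span (`pProd_mem_span_reduced`): if x_e is a
combination of later members of A, expanding it in p trades e for those members one at a time and
keeps the span of A, hence the condition on J. They are independent (`eq_zero_of_sum_reduced`) by
deletion and contraction of the last vector x: relations are reduced modulo x, and what remains is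
divided by x. So the Hilbert series is the sum of t^(N-|A|) over these reduced sets. The same
deletion and contraction (`sum_reduced_eq`) turns it into a sum over all A with clos(A) in J, with
weight t^(N-|A|)(1-t)^(|A|-rk A), which is the stated formula after writing 1-t = t(1/t-1). For the
external space, a linear form times p_Y with X \ Y spanning expands into products p_{Y ∪ i}
(`PSpace_bot_eq_external`). -/

/-- A sum over all sets of indices below `n + 1`, split according to whether the last index
belongs to the set. -/
theorem sum_finset_fin_succ {M : Type*} [AddCommMonoid M] {n : ℕ}
    (f : Finset (Fin (n + 1)) → M) :
    ∑ A, f A = ∑ A : Finset (Fin n), f (A.map Fin.castSuccEmb) +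
      ∑ A : Finset (Fin n), f (insert (Fin.last n) (A.map Fin.castSuccEmb)) := by
  have hmem : Fin.last n ∉ (Finset.univ : Finset (Fin n)).map Fin.castSuccEmb := by
    simp [Fin.castSucc_ne_last]
  have huniv : (Finset.univ : Finset (Finset (Fin (n + 1)))) =
      (insert (Fin.last n) ((Finset.univ : Finset (Fin n)).map Fin.castSuccEmb)).powerset := by
    rw [← Finset.powerset_univ, Fin.univ_castSuccEmb, Finset.cons_eq_insert]
  have hpow : ((Finset.univ : Finset (Fin n)).map Fin.castSuccEmb).powerset =
      Finset.univ.map (Finset.mapEmbedding Fin.castSuccEmb).toEmbedding := by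
    ext B
    simp only [Finset.mem_powerset, Finset.subset_map_iff, Finset.mem_map, Finset.mem_univ,
      true_and, Finset.subset_univ, RelEmbedding.coe_toEmbedding, Finset.mapEmbedding_apply]
    exact exists_congr fun _ => eq_comm
  rw [huniv, Finset.sum_powerset_insert hmem, hpow, Finset.sum_map, Finset.sum_map]
  simp

theorem compl_map_castSucc {n : ℕ} (A : Finset (Fin n)) :
    (A.map Fin.castSuccEmb)ᶜ = insert (Fin.last n) (Aᶜ.map Fin.castSuccEmb) := by
  ext i
  induction i using Fin.lastCases <;> simp [Fin.castSucc_ne_last]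

theorem compl_insert_last_map_castSucc {n : ℕ} (A : Finset (Fin n)) :
    (insert (Fin.last n) (A.map Fin.castSuccEmb))ᶜ = Aᶜ.map Fin.castSuccEmb := by
  ext i
  induction i using Fin.lastCases <;> simp [Fin.castSucc_ne_last]

theorem last_notMem_map_castSucc {n : ℕ} (A : Finset (Fin n)) :
    Fin.last n ∉ A.map Fin.castSuccEmb := by
  simp [Fin.castSucc_ne_last]

end Combinatorics

/-! ### Reduced sets under deletion and contraction, and their generating function. -/

section Reduced

universe u

variable {K : Type*} {U : Type u} [Field K] [AddCommGroup U] [Module K U] {N : ℕ}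

variable (K) in
/-- The span of the members of the subsequence `A`. -/
abbrev spanOf (X : Fin N → U) (A : Finset (Fin N)) : Submodule K U :=
  Submodule.span K (X '' (A : Set (Fin N)))

variable (K) in
/-- A subsequence `A` is reduced if no `x_e` outside `A` is a linear combination of the members
of `A` that come after it. These are the sets obtained from an independent set by adding its
externally active elements. -/
def Reduced (X : Fin N → U) (A : Finset (Fin N)) : Prop :=
  ∀ e ∉ A, X e ∉ Submodule.span K (X '' {i | i ∈ A ∧ e < i})

theorem spanOf_map_castSucc {n : ℕ} (X : Fin (n + 1) → U) (A : Finset (Fin n)) :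
    spanOf K X (A.map Fin.castSuccEmb) = spanOf K (X ∘ Fin.castSucc) A := by
  simp [spanOf, Set.image_image]

theorem spanOf_insert_last {n : ℕ} (X : Fin (n + 1) → U) (A : Finset (Fin n)) :
    spanOf K X (insert (Fin.last n) (A.map Fin.castSuccEmb)) =
      (spanOf K ((K ∙ X (Fin.last n)).mkQ ∘ X ∘ Fin.castSucc) A).comap
        (K ∙ X (Fin.last n)).mkQ := by
  rw [spanOf, spanOf, Set.image_comp, Submodule.span_image, Submodule.comap_map_mkQ,
    Finset.coe_insert, Set.image_insert_eq, Submodule.span_insert]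
  simp [Set.image_image]

/-- Nothing comes after the last index, so the condition there only says that its vector is not in
the zero space. -/
theorem reduced_map_castSucc {n : ℕ} (X : Fin (n + 1) → U) (A : Finset (Fin n)) :
    Reduced K X (A.map Fin.castSuccEmb) ↔
      X (Fin.last n) ≠ 0 ∧ Reduced K (X ∘ Fin.castSucc) A := by
  have h1 : {i | i ∈ A.map Fin.castSuccEmb ∧ Fin.last n < i} = ∅ := by
    ext i; simp [Fin.le_last]
  have h2 (e : Fin n) : X '' {i | i ∈ A.map Fin.castSuccEmb ∧ e.castSucc < i} =
      (X ∘ Fin.castSucc) '' {i | i ∈ A ∧ e < i} := by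
    rw [Set.image_comp]
    congr 1
    ext i
    induction i using Fin.lastCases <;> simp [Fin.castSucc_ne_last]
  rw [Reduced, Fin.forall_fin_succ', and_comm]
  simp only [h1, h2]
  simp [Reduced, Fin.castSucc_ne_last]

/-- The last vector comes after every other index, so every span in the definition contains it and
membership can be tested modulo it. -/
theorem reduced_insert_last {n : ℕ} (X : Fin (n + 1) → U) (A : Finset (Fin n)) :
    Reduced K X (insert (Fin.last n) (A.map Fin.castSuccEmb)) ↔
      Reduced K ((K ∙ X (Fin.last n)).mkQ ∘ X ∘ Fin.castSucc) A := by
  have h2 (e : Fin n) :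
      {i | i ∈ insert (Fin.last n) (A.map Fin.castSuccEmb) ∧ e.castSucc < i} =
      insert (Fin.last n) (Fin.castSucc '' {i | i ∈ A ∧ e < i}) := by
    ext i
    induction i using Fin.lastCases <;> simp [Fin.castSucc_ne_last, Fin.castSucc_lt_last]
  have h3 (e : Fin n) :
      X e.castSucc ∈ Submodule.span K (X '' {i | i ∈ insert (Fin.last n)
        (A.map Fin.castSuccEmb) ∧ e.castSucc < i}) ↔
      ((K ∙ X (Fin.last n)).mkQ ∘ X ∘ Fin.castSucc) e ∈ Submodule.span K
        (((K ∙ X (Fin.last n)).mkQ ∘ X ∘ Fin.castSucc) '' {i | i ∈ A ∧ e < i}) := by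
    rw [h2, Set.image_comp, Submodule.span_image, Function.comp_apply, ← Submodule.mem_comap,
      Submodule.comap_map_mkQ, Set.image_insert_eq, Submodule.span_insert, Set.image_comp]
    rfl
  rw [Reduced, Fin.forall_fin_succ']
  simp only [h3]
  simp [Reduced, Fin.castSucc_ne_last]

theorem rank_insert_last {n : ℕ} (X : Fin (n + 1) → U) (hx : X (Fin.last n) ≠ 0)
    (A : Finset (Fin n)) :
    rank (K := K) X (insert (Fin.last n) (A.map Fin.castSuccEmb)) =
      rank (K := K) ((K ∙ X (Fin.last n)).mkQ ∘ X ∘ Fin.castSucc) A + 1 := by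
  set S := spanOf K X (insert (Fin.last n) (A.map Fin.castSuccEmb)) with hS
  have hle : (K ∙ X (Fin.last n)) ≤ S := by
    rw [Submodule.span_singleton_le_iff_mem]
    exact Submodule.subset_span ⟨Fin.last n, by simp, rfl⟩
  have : FiniteDimensional K S := FiniteDimensional.span_of_finite K (Set.toFinite _)
  have hmap : S.map (K ∙ X (Fin.last n)).mkQ =
      spanOf K ((K ∙ X (Fin.last n)).mkQ ∘ X ∘ Fin.castSucc) A := by
    rw [hS, spanOf_insert_last, Submodule.map_comap_eq_of_surjective (Submodule.mkQ_surjective _)]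
  have h := LinearMap.finrank_range_add_finrank_ker ((K ∙ X (Fin.last n)).mkQ.domRestrict S)
  rw [LinearMap.range_domRestrict, hmap] at h
  have hker : Module.finrank K
      (LinearMap.ker ((K ∙ X (Fin.last n)).mkQ.domRestrict S)) = 1 := by
    rw [LinearMap.ker_domRestrict, Submodule.ker_mkQ,
      (Submodule.comapSubtypeEquivOfLe hle).finrank_eq, finrank_span_singleton hx]
  rw [hker] at h
  exact h.symm

theorem rank_map_castSucc {n : ℕ} (X : Fin (n + 1) → U) (A : Finset (Fin n)) :
    rank (K := K) X (A.map Fin.castSuccEmb) = rank (K := K) (X ∘ Fin.castSucc) A :=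
  congrArg (fun S : Submodule K U => Module.finrank K S) (spanOf_map_castSucc X A)

theorem rank_le_card (X : Fin N → U) (A : Finset (Fin N)) : rank (K := K) X A ≤ A.card := by
  classical
  rw [rank, ← Finset.coe_image]
  exact (finrank_span_finset_le_card _).trans Finset.card_image_le

open Classical in
/-- The generating function of reduced sets, by deletion and contraction of the last element. -/
theorem sum_reduced_eq {R : Type*} [CommRing R] (s : R) (n : ℕ) :
    ∀ {U : Type u} [AddCommGroup U] [Module K U] (X : Fin n → U) (Q : Submodule K U → Prop),
      (∑ A : Finset (Fin n), if Reduced K X A ∧ Q (spanOf K X A) then s ^ (n - A.card) else 0) =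
      ∑ A : Finset (Fin n), if Q (spanOf K X A) then
        s ^ (n - A.card) * (1 - s) ^ (A.card - rank (K := K) X A) else 0 := by
  -- `U` and `Q` vary in the induction: contraction passes to the quotient by the last vector and
  -- pulls `Q` back along the quotient map.
  induction n with
  | zero =>
    intro U _ _ X Q
    refine Finset.sum_congr rfl fun A _ => ?_
    have h : Reduced K X A := fun e => e.elim0
    have hA : A.card = 0 := by simp [Subsingleton.elim A ∅]
    simp [h, hA]
  | succ n ih =>
    intro U _ _ X Q
    have hle (A : Finset (Fin n)) : n + 1 - A.card = n - A.card + 1 := by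
      have := A.card_le_univ
      rw [Fintype.card_fin] at this
      omega
    rw [sum_finset_fin_succ, sum_finset_fin_succ]
    simp only [Finset.card_map, Finset.card_insert_of_notMem (last_notMem_map_castSucc _),
      rank_map_castSucc, Nat.add_sub_add_right, hle, spanOf_map_castSucc, reduced_map_castSucc,
      reduced_insert_last, pow_succ']
    -- For a loop, only sets containing it can be reduced, while on the right the two terms of each
    -- pair have weights s and 1 - s, adding to 1.
    by_cases hx : X (Fin.last n) = 0
    · have hspan (A : Finset (Fin n)) :
          spanOf K X (insert (Fin.last n) (A.map Fin.castSuccEmb)) =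
            spanOf K (X ∘ Fin.castSucc) A := by
        rw [spanOf, Finset.coe_insert, Set.image_insert_eq, hx, Submodule.span_insert_zero]
        exact spanOf_map_castSucc X A
      have hred (A : Finset (Fin n)) :
          Reduced K ((K ∙ X (Fin.last n)).mkQ ∘ X ∘ Fin.castSucc) A ↔
            Reduced K (X ∘ Fin.castSucc) A := by
        have hinj : Function.Injective (K ∙ X (Fin.last n)).mkQ := by
          rw [← LinearMap.ker_eq_bot, Submodule.ker_mkQ, hx, Submodule.span_zero_singleton]
        refine forall₂_congr fun e _ => not_congr ?_
        rw [Set.image_comp, Submodule.span_image]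
        exact hinj.mem_set_image
      have hrank (A : Finset (Fin n)) :
          rank (K := K) X (insert (Fin.last n) (A.map Fin.castSuccEmb)) =
            rank (K := K) (X ∘ Fin.castSucc) A :=
        congrArg (fun S : Submodule K U => Module.finrank K S) (hspan A)
      simp only [hspan, hred, hrank, hx, ne_eq, not_true_eq_false, false_and, if_false,
        Finset.sum_const_zero, zero_add]
      rw [ih, ← Finset.sum_add_distrib]
      refine Finset.sum_congr rfl fun A _ => ?_
      have : A.card + 1 - rank (K := K) (X ∘ Fin.castSucc) A =
          A.card - rank (K := K) (X ∘ Fin.castSucc) A + 1 := by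
        have := rank_le_card (K := K) (X ∘ Fin.castSucc) A
        omega
      split_ifs
      · rw [this]; ring
      · simp
    -- Otherwise deletion contributes a factor s, and contraction lowers size and rank together,
    -- leaving the exponent of 1 - s unchanged.
    · simp only [spanOf_insert_last, rank_insert_last X hx, Nat.add_sub_add_right, hx,
        ne_eq, not_false_eq_true, true_and, mul_assoc]
      have h1 := ih (X ∘ Fin.castSucc) Q
      have h2 := ih ((K ∙ X (Fin.last n)).mkQ ∘ X ∘ Fin.castSucc)
        fun W => Q (W.comap (K ∙ X (Fin.last n)).mkQ)
      rw [h2]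
      congr 1
      simpa only [Finset.mul_sum, mul_ite, mul_zero] using congrArg (s * ·) h1

end Reduced
-- The basis of products indexed by reduced sets.
section Basis

universe u

variable {K : Type*} {U : Type u} [Field K] [AddCommGroup U] [Module K U] {N : ℕ}

theorem ι_ne_zero {x : U} (hx : x ≠ 0) : SymmetricAlgebra.ι K U x ≠ 0 := by
  obtain ⟨f, hf⟩ := Module.Projective.exists_dual_ne_zero K hx
  intro h
  apply hf
  simpa [h] using (SymmetricAlgebra.lift_ι_apply f x).symm

theorem pProd_map_castSucc {n : ℕ} (X : Fin (n + 1) → U) (A : Finset (Fin n)) :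
    pProd K X (A.map Fin.castSuccEmb) = pProd K (X ∘ Fin.castSucc) A := by
  simp [pProd]

theorem pProd_insert_last {n : ℕ} (X : Fin (n + 1) → U) (A : Finset (Fin n)) :
    pProd K X (insert (Fin.last n) (A.map Fin.castSuccEmb)) =
      SymmetricAlgebra.ι K U (X (Fin.last n)) * pProd K (X ∘ Fin.castSucc) A := by
  rw [pProd, Finset.prod_insert (last_notMem_map_castSucc A)]
  exact congrArg _ (pProd_map_castSucc X A)

theorem lift_pProd {W : Type*} [AddCommGroup W] [Module K W] (f : U →ₗ[K] W) (X : Fin N → U)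
    (Y : Finset (Fin N)) :
    SymmetricAlgebra.lift (SymmetricAlgebra.ι K W ∘ₗ f) (pProd K X Y) = pProd K (f ∘ X) Y := by
  simp [pProd]

/-- The products of the complements of reduced sets satisfy no linear relation. -/
theorem eq_zero_of_sum_reduced (n : ℕ) :
    ∀ {U : Type u} [AddCommGroup U] [Module K U] (X : Fin n → U) (c : Finset (Fin n) → K),
      (∀ A, ¬ Reduced K X A → c A = 0) → ∑ A, c A • pProd K X Aᶜ = 0 → ∀ A, c A = 0 := by
  induction n with
  | zero =>
    intro U _ _ X c _ h A
    rw [Fintype.sum_subsingleton _ A] at h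
    simpa [pProd, Subsingleton.elim Aᶜ ∅] using h
  | succ n ih =>
    intro U _ _ X c hc h
    rw [sum_finset_fin_succ] at h
    simp only [compl_map_castSucc, compl_insert_last_map_castSucc, pProd_insert_last,
      pProd_map_castSucc] at h
    -- Modulo the last vector, the terms of sets omitting it vanish, since their complements contain
    -- it; a relation for the contraction is left.
    have hins : ∀ A : Finset (Fin n), c (insert (Fin.last n) (A.map Fin.castSuccEmb)) = 0 := by
      refine ih ((K ∙ X (Fin.last n)).mkQ ∘ X ∘ Fin.castSucc) _
        (fun A hA => hc _ (mt (reduced_insert_last X A).1 hA)) ?_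
      have := congrArg (SymmetricAlgebra.lift
        (SymmetricAlgebra.ι K _ ∘ₗ (K ∙ X (Fin.last n)).mkQ)) h
      have h0 : (K ∙ X (Fin.last n)).mkQ (X (Fin.last n)) = 0 := by simp
      simpa only [map_add, map_sum, map_smul, map_mul, lift_pProd, SymmetricAlgebra.lift_ι_apply,
        LinearMap.comp_apply, h0, map_zero, zero_mul, smul_zero, Finset.sum_const_zero,
        zero_add] using this
    have hmap : ∀ A : Finset (Fin n), c (A.map Fin.castSuccEmb) = 0 := by
      by_cases hx : X (Fin.last n) = 0
      · exact fun A => hc _ fun hA => ((reduced_map_castSucc X A).1 hA).1 hx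
      · refine ih (X ∘ Fin.castSucc) _
          (fun A hA => hc _ fun h => hA ((reduced_map_castSucc X A).1 h).2) ?_
        -- The surviving terms share the last vector as a factor, which cancels because the
        -- symmetric algebra is a domain.
        simp only [hins, zero_smul, Finset.sum_const_zero, add_zero, ← mul_smul_comm,
          ← Finset.mul_sum] at h
        exact (mul_eq_zero.1 h).resolve_left (ι_ne_zero hx)
    classical
    intro A
    by_contra hA
    -- Counting the nonzero coefficients lets the split of the sum stand in for a case distinction
    -- on whether `A` contains the last index.
    have h1 : ∑ B : Finset (Fin (n + 1)), (if c B = 0 then 0 else 1) = 0 := by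
      rw [sum_finset_fin_succ]
      simp [hins, hmap]
    have h2 := (Finset.sum_eq_zero_iff.1 h1) A (Finset.mem_univ A)
    simp [hA] at h2

theorem linearIndependent_pProd_reduced (X : Fin N → U) :
    LinearIndependent K fun A : {A : Finset (Fin N) // Reduced K X A} => pProd K X A.1ᶜ := by
  classical
  rw [Fintype.linearIndependent_iff]
  intro g hg A
  have := eq_zero_of_sum_reduced N X (fun A => if h : Reduced K X A then g ⟨A, h⟩ else 0)
    (fun A hA => dif_neg hA) ?_ A
  · simpa [A.2] using this
  · rw [← hg, ← Finset.sum_subset (Finset.subset_univ (Finset.univ.filter (Reduced K X)))]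
    · rw [Finset.sum_subtype (p := Reduced K X) _ (by simp)]
      exact Finset.sum_congr rfl fun B _ => by rw [dif_pos B.2]
    · intro B _ hB
      rw [dif_neg (by simpa using hB), zero_smul]

/-- Steinitz exchange: since `c i ≠ 0`, the relation can be solved for `X i`. -/
theorem spanOf_insert_erase (X : Fin N → U) {A : Finset (Fin N)} {e i : Fin N} {c : Fin N → K}
    {B : Finset (Fin N)} (hB : B ⊆ A) (hc : ∑ j ∈ B, c j • X j = X e) (hi : i ∈ B)
    (hci : c i ≠ 0) :
    spanOf K X (insert e (A.erase i)) = spanOf K X A := by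
  classical
  apply le_antisymm
  · rw [Submodule.span_le]
    rintro _ ⟨j, hj, rfl⟩
    rcases Finset.mem_insert.1 (Finset.mem_coe.1 hj) with rfl | hj
    · rw [← hc]
      exact Submodule.sum_mem _ fun k hk =>
        Submodule.smul_mem _ _ (Submodule.subset_span ⟨k, hB hk, rfl⟩)
    · exact Submodule.subset_span ⟨j, Finset.mem_of_mem_erase hj, rfl⟩
  · rw [Submodule.span_le]
    rintro _ ⟨j, hj, rfl⟩
    by_cases hji : j = i
    · subst hji
      have h : X j = (c j)⁻¹ • (X e - ∑ k ∈ B.erase j, c k • X k) := by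
        rw [← hc, ← Finset.add_sum_erase B _ hi, add_sub_cancel_right, inv_smul_smul₀ hci]
      rw [h]
      refine Submodule.smul_mem _ _ (Submodule.sub_mem _
        (Submodule.subset_span ⟨e, by simp, rfl⟩) (Submodule.sum_mem _ fun k hk =>
          Submodule.smul_mem _ _ (Submodule.subset_span ⟨k, ?_, rfl⟩)))
      have := Finset.mem_erase.1 hk
      simp [this.1, hB this.2]
    · exact Submodule.subset_span ⟨j, by simp [hji, Finset.mem_coe.1 hj], rfl⟩

/-- Exchanging elements reduces every product to products of complements of reduced sets with the
same span. -/
theorem pProd_mem_span_reduced (X : Fin N → U) (Q : Submodule K U → Prop) (A : Finset (Fin N))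
    (hA : Q (spanOf K X A)) :
    pProd K X Aᶜ ∈ Submodule.span K
      {q | ∃ B, (Reduced K X B ∧ Q (spanOf K X B)) ∧ q = pProd K X Bᶜ} := by
  classical
  -- The exchange replaces some i > e by e, so the sum of the indices strictly drops.
  induction hm : ∑ i ∈ A, (i : ℕ) using Nat.strong_induction_on generalizing A with
  | _ m ih =>
    by_cases hred : Reduced K X A
    · exact Submodule.subset_span ⟨A, ⟨hred, hA⟩, rfl⟩
    · simp only [Reduced, not_forall, not_not] at hred
      obtain ⟨e, he, hspan⟩ := hred
      have hset : {i | i ∈ A ∧ e < i} = ((A.filter (e < ·) : Finset (Fin N)) : Set (Fin N)) := by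
        ext; simp
      rw [hset, Submodule.mem_span_image_finset_iff_exists_fun'] at hspan
      obtain ⟨c, hc⟩ := hspan
      have hp : pProd K X Aᶜ = ∑ i ∈ A.filter (e < ·),
          c i • pProd K X (insert e (A.erase i))ᶜ := by
        have heA : e ∈ Aᶜ := by simpa using he
        rw [pProd, ← Finset.mul_prod_erase _ _ heA, ← hc, map_sum, Finset.sum_mul]
        refine Finset.sum_congr rfl fun i hi => ?_
        have hiA := (Finset.mem_filter.1 hi).1
        have hcompl : (insert e (A.erase i))ᶜ = insert i (Aᶜ.erase e) := by
          ext j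
          simp only [Finset.mem_compl, Finset.mem_insert, Finset.mem_erase]
          have : i ≠ e := fun h => he (h ▸ hiA)
          grind
        rw [hcompl, pProd, Finset.prod_insert (by simp [hiA]), map_smul, smul_mul_assoc]
      rw [hp]
      refine Submodule.sum_mem _ fun i hi => ?_
      by_cases hci : c i = 0
      · simp [hci]
      refine Submodule.smul_mem _ _ (ih _ ?_ (insert e (A.erase i)) ?_ rfl)
      · obtain ⟨hiA, hei⟩ := Finset.mem_filter.1 hi
        rw [Finset.sum_insert (by simp [he]), ← hm, ← Finset.add_sum_erase A _ hiA]
        exact Nat.add_lt_add_right hei _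
      · rwa [spanOf_insert_erase X (Finset.filter_subset _ _) hc hi hci]

end Basis

/-! ### Extracting homogeneous components. -/

section Grading

variable {K U : Type*} [Field K] [AddCommGroup U] [Module K U]

variable (K U) in
/-- The algebra map recording the degree as the exponent of a polynomial variable. -/
noncomputable def degreeHom :
    SymmetricAlgebra K U →ₐ[K] Polynomial (SymmetricAlgebra K U) :=
  SymmetricAlgebra.lift
    ((Polynomial.monomial 1).restrictScalars K ∘ₗ SymmetricAlgebra.ι K U)

theorem degreeHom_of_mem {i : ℕ} {f : SymmetricAlgebra K U} (hf : f ∈ symComponent K U i) :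
    degreeHom K U f = Polynomial.monomial i f := by
  induction i generalizing f with
  | zero =>
    rw [symComponent, pow_zero, Submodule.mem_one] at hf
    obtain ⟨a, rfl⟩ := hf
    rw [AlgHom.commutes]
    rfl
  | succ i ih =>
    rw [symComponent, pow_succ] at hf
    induction hf using Submodule.mul_induction_on' with
    | mem_mul_mem a ha b hb =>
      obtain ⟨u, rfl⟩ := hb
      rw [map_mul, ih ha, degreeHom, SymmetricAlgebra.lift_ι_apply]
      exact Polynomial.monomial_mul_monomial _ _ _ _
    | add a _ b _ ha hb => rw [map_add, ha, hb, map_add]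

/-- The dimension of a homogeneous component of a subspace with a homogeneous basis. -/
theorem finrank_span_inf_symComponent {α : Type*} [Fintype α] (b : α → SymmetricAlgebra K U)
    (d : α → ℕ) (hb : LinearIndependent K b) (hd : ∀ a, b a ∈ symComponent K U (d a)) (i : ℕ) :
    Module.finrank K (Submodule.span K (Set.range b) ⊓ symComponent K U i : Submodule K _) =
      Fintype.card {a // d a = i} := by
  classical
  have h : Submodule.span K (Set.range b) ⊓ symComponent K U i =
      Submodule.span K (Set.range fun a : {a // d a = i} => b a) := by
    apply le_antisymm
    · rintro v ⟨hv, hvi⟩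
      obtain ⟨c, rfl⟩ := (Submodule.mem_span_range_iff_exists_fun K).1 hv
      -- Coefficient i of the degree map discards every basis vector of degree other than i, so v is
      -- its own truncation.
      have h1 := congrArg (fun p => Polynomial.coeff p i) (degreeHom_of_mem hvi)
      simp only [map_sum, map_smul, degreeHom_of_mem (hd _), Polynomial.finsetSum_coeff,
        Polynomial.coeff_smul, Polynomial.coeff_monomial, if_true] at h1
      rw [← h1]
      refine Submodule.sum_mem _ fun a _ => Submodule.smul_mem _ _ ?_
      split_ifs with ha
      · exact Submodule.subset_span ⟨⟨a, ha⟩, rfl⟩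
      · exact Submodule.zero_mem _
    · rw [Submodule.span_le]
      rintro _ ⟨a, rfl⟩
      refine ⟨Submodule.subset_span ⟨a, rfl⟩, ?_⟩
      have := hd a
      rwa [a.2] at this
  rw [h]
  exact finrank_span_eq_card (hb.comp _ Subtype.val_injective)

end Grading
-- Hilbert series of the zonotopal spaces.
section Hilbert

variable {K U : Type*} [Field K] [AddCommGroup U] [Module K U] {N : ℕ}

/-- The predicate on subspaces saying that they are spanned by a flat in `J`. -/
def IsSpanOfFlat {X : Fin N → U} (J : UpperSet (Flat K X)) (W : Submodule K U) : Prop :=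
  ∃ C ∈ J, spanOf K X C.1 = W

theorem spanOf_clos (X : Fin N → U) (A : Finset (Fin N)) :
    spanOf K X (clos K X A) = spanOf K X A := by
  apply le_antisymm
  · rw [Submodule.span_le]
    rintro _ ⟨j, hj, rfl⟩
    exact (mem_clos_iff X A j).1 hj
  · refine Submodule.span_mono (Set.image_mono fun j hj => ?_)
    exact (mem_clos_iff X A j).2 (Submodule.subset_span ⟨j, hj, rfl⟩)

theorem clos_eq_of_spanOf_eq {X : Fin N → U} {A B : Finset (Fin N)}
    (h : spanOf K X A = spanOf K X B) : clos K X A = clos K X B := by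
  ext i
  rw [mem_clos_iff, mem_clos_iff, show Submodule.span K (X '' (A : Set (Fin N))) = _ from h]

/-- Membership of the closure in `J` depends only on the span; this puts it in the form `Q` required
by the exchange and counting lemmas. -/
theorem isSpanOfFlat_spanOf {X : Fin N → U} (J : UpperSet (Flat K X)) (A : Finset (Fin N)) :
    IsSpanOfFlat J (spanOf K X A) ↔ closFlat K X A ∈ J := by
  constructor
  · rintro ⟨C, hC, h⟩
    have : closFlat K X A = C := Subtype.ext ((clos_eq_of_spanOf_eq h).symm.trans C.2)
    rwa [this]
  · exact fun h => ⟨_, h, spanOf_clos X A⟩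

theorem chi_eq_one_iff {X : Fin N → U} (J : UpperSet (Flat K X)) (A : Finset (Fin N)) :
    chi J A = 1 ↔ closFlat K X A ∈ J := by
  simp [chi]

theorem PSpace_zero_eq_span_reduced {X : Fin N → U} (J : UpperSet (Flat K X)) :
    PSpace 0 J = Submodule.span K (Set.range
      fun A : {A // Reduced K X A ∧ IsSpanOfFlat J (spanOf K X A)} => pProd K X A.1ᶜ) := by
  apply le_antisymm
  · rw [PSpace, Submodule.span_le]
    rintro _ ⟨Y, hY, rfl⟩
    have := pProd_mem_span_reduced X (IsSpanOfFlat J) Yᶜ ((isSpanOfFlat_spanOf J _).2 hY)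
    rw [compl_compl] at this
    refine Submodule.span_mono ?_ this
    rintro _ ⟨B, hB, rfl⟩
    exact ⟨⟨B, hB⟩, rfl⟩
  · rw [Submodule.span_le]
    rintro _ ⟨A, rfl⟩
    refine Submodule.subset_span ⟨(A : Finset (Fin N))ᶜ, ?_, rfl⟩
    rw [compl_compl]
    exact (isSpanOfFlat_spanOf J _).1 A.2.2

theorem linearIndependent_pProd_reduced_of_mem {X : Fin N → U} (J : UpperSet (Flat K X)) :
    LinearIndependent K
      fun A : {A // Reduced K X A ∧ IsSpanOfFlat J (spanOf K X A)} => pProd K X A.1ᶜ := by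
  let f : {A // Reduced K X A ∧ IsSpanOfFlat J (spanOf K X A)} → {A // Reduced K X A} :=
    Subtype.map id fun _ h => h.1
  have hf : Function.Injective f := Subtype.map_injective _ Function.injective_id
  exact (linearIndependent_pProd_reduced X).comp f hf

open Classical in
theorem hilbertSeries_PSpace_zero {X : Fin N → U} (J : UpperSet (Flat K X)) :
    hilbertSeries (PSpace 0 J) = ∑ A : Finset (Fin N),
      if Reduced K X A ∧ IsSpanOfFlat J (spanOf K X A) then
        (PowerSeries.X : PowerSeries ℚ) ^ (N - A.card) else 0 := by
  have hfin (i : ℕ) := finrank_span_inf_symComponent _ (fun A => (A.1ᶜ).card)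
    (linearIndependent_pProd_reduced_of_mem J) (fun A => pProd_mem X (A.1ᶜ)) i
  rw [← PSpace_zero_eq_span_reduced] at hfin
  rw [← Finset.sum_filter, Finset.sum_subtype (p := fun A => Reduced K X A ∧
    IsSpanOfFlat J (spanOf K X A)) (F := inferInstance) _ fun A => Finset.mem_filter_univ A]
  ext i
  rw [hilbertSeries, PowerSeries.coeff_mk, hfin i, Fintype.card_subtype, map_sum]
  simp [PowerSeries.coeff_X_pow, Finset.card_compl, eq_comm]

theorem closFlat_mem_Ici_topFlat_iff (X : Fin N → U) (A : Finset (Fin N)) :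
    closFlat K X A ∈ UpperSet.Ici (topFlat K X) ↔
      rank (K := K) X A = rank (K := K) X Finset.univ := by
  have hfin : FiniteDimensional K (spanOf K X (Finset.univ : Finset (Fin N))) :=
    FiniteDimensional.span_of_finite K (Set.toFinite _)
  have hle : spanOf K X A ≤ spanOf K X Finset.univ :=
    Submodule.span_mono (Set.image_mono (by simp))
  rw [UpperSet.mem_Ici_iff]
  constructor
  · intro h
    have h1 : clos K X A = Finset.univ := Finset.univ_subset_iff.1 h
    have h2 := spanOf_clos (K := K) X A
    rw [h1] at h2
    exact congrArg (fun S : Submodule K U => Module.finrank K S) h2.symm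
  · intro h
    have h1 := clos_eq_of_spanOf_eq (Submodule.eq_of_le_of_finrank_eq hle h)
    exact (h1.trans (topFlat K X).2).ge

/-- A linear form is a combination of the x_i with i outside `Y`, and x_i p_Y is again a product
over a subsequence. -/
theorem symComponent_one_mul_pProd_mem {X : Fin N → U} {Y : Finset (Fin N)}
    (hY : spanOf K X Yᶜ = ⊤) {f : SymmetricAlgebra K U} (hf : f ∈ symComponent K U 1) :
    f * pProd K X Y ∈ PSpace 0 (⊥ : UpperSet (Flat K X)) := by
  classical
  rw [symComponent, pow_one] at hf
  obtain ⟨u, rfl⟩ := hf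
  have hu : u ∈ spanOf K X Yᶜ := hY ▸ Submodule.mem_top
  rw [spanOf, Submodule.mem_span_image_finset_iff_exists_fun'] at hu
  obtain ⟨c, rfl⟩ := hu
  rw [map_sum, Finset.sum_mul]
  refine Submodule.sum_mem _ fun i hi => ?_
  rw [map_smul, smul_mul_assoc]
  refine Submodule.smul_mem _ _ (Submodule.subset_span ⟨insert i Y, trivial, ?_⟩)
  rw [pProd, pProd, Finset.prod_insert (Finset.mem_compl.1 hi)]

/-- The external space is spanned by all products of members of `X`. -/
theorem PSpace_bot_eq_external {X : Fin N → U} (hX : Submodule.span K (Set.range X) = ⊤) :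
    PSpace 0 (⊥ : UpperSet (Flat K X)) = PSpace 1 (UpperSet.Ici (topFlat K X)) := by
  classical
  have htop : spanOf K X Finset.univ = ⊤ := by simpa [spanOf] using hX
  have hone : (1 : SymmetricAlgebra K U) ∈ symComponent K U 0 := by
    rw [symComponent, pow_zero]; exact Submodule.one_le.1 le_rfl
  apply le_antisymm
  · rw [PSpace, Submodule.span_le]
    rintro _ ⟨Y, -, rfl⟩
    refine Submodule.subset_span ⟨Y, 1, ?_, (one_mul _).symm⟩
    exact Submodule.mem_iSup_of_mem 0 (Submodule.mem_iSup_of_mem (by simp) hone)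
  · conv_lhs => rw [PSpace]
    rw [Submodule.span_le]
    rintro _ ⟨Y, f, hf, rfl⟩
    have key : (⨆ i ∈ Finset.range (chi (UpperSet.Ici (topFlat K X)) Yᶜ + 0 + 1),
        symComponent K U i) ≤ (PSpace 0 (⊥ : UpperSet (Flat K X))).comap
          (LinearMap.mulRight K (pProd K X Y)) := by
      refine iSup₂_le fun i hi g hg => ?_
      change g * pProd K X Y ∈ PSpace 0 (⊥ : UpperSet (Flat K X))
      have h0 {g : SymmetricAlgebra K U} (hg : g ∈ symComponent K U 0) :
          g * pProd K X Y ∈ PSpace 0 (⊥ : UpperSet (Flat K X)) := by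
        rw [symComponent, pow_zero, Submodule.mem_one] at hg
        obtain ⟨a, rfl⟩ := hg
        rw [← Algebra.smul_def]
        exact Submodule.smul_mem _ _ (Submodule.subset_span ⟨Y, trivial, rfl⟩)
      -- Linear factors are allowed only when the complement of `Y` spans; otherwise f is constant.
      by_cases hY : closFlat K X Yᶜ ∈ UpperSet.Ici (topFlat K X)
      · have hspan : spanOf K X Yᶜ = ⊤ := by
          rw [← spanOf_clos, ← htop]
          congr 1
          exact Finset.univ_subset_iff.1 hY
        rw [(chi_eq_one_iff _ _).2 hY, Finset.mem_range] at hi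
        interval_cases i
        · exact h0 hg
        · exact symComponent_one_mul_pProd_mem hspan hg
      · rw [chi, if_neg hY, Finset.mem_range] at hi
        interval_cases i
        exact h0 hg
    exact key hf

theorem t_ne_zero : t ≠ 0 := by
  rw [t]
  simp

/-- Moving powers of `t` between the two forms of the terms of the Hilbert series. -/
theorem t_pow_mul_pow {N r k a : ℕ} (hkr : k ≤ r) (hrN : r ≤ N) (hka : k ≤ a) (haN : a ≤ N) :
    t ^ (N - r) * (t ^ (r - k) * (1 / t - 1) ^ (a - k)) = t ^ (N - a) * (1 - t) ^ (a - k) := by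
  have h : 1 - t = t * (1 / t - 1) := by
    field_simp [t_ne_zero]
  rw [h, mul_pow, ← mul_assoc, ← mul_assoc, ← pow_add, ← pow_add]
  congr 2
  omega

theorem rank_le_rank_univ (X : Fin N → U) (A : Finset (Fin N)) :
    rank (K := K) X A ≤ rank (K := K) X Finset.univ := by
  have : FiniteDimensional K (spanOf K X (Finset.univ : Finset (Fin N))) :=
    FiniteDimensional.span_of_finite K (Set.toFinite _)
  exact Submodule.finrank_mono (Submodule.span_mono (Set.image_mono (by simp)))

theorem coe_hilbertSeries_PSpace_zero {X : Fin N → U} (J : UpperSet (Flat K X)) :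
    (hilbertSeries (PSpace 0 J) : LaurentSeries ℚ) =
      t ^ (N - rank (K := K) X Finset.univ) * ∑ A : Finset (Fin N) with chi J A = 1,
        t ^ (rank (K := K) X Finset.univ - rank (K := K) X A) *
          (1 / t - 1) ^ (A.card - rank (K := K) X A) := by
  classical
  have hcard (A : Finset (Fin N)) : A.card ≤ N := by simpa using A.card_le_univ
  rw [hilbertSeries_PSpace_zero, Finset.mul_sum]
  have h := sum_reduced_eq (K := K) t N X (IsSpanOfFlat J)
  have hcoe : ((∑ A : Finset (Fin N), if Reduced K X A ∧ IsSpanOfFlat J (spanOf K X A) then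
        (PowerSeries.X : PowerSeries ℚ) ^ (N - A.card) else 0 : PowerSeries ℚ) :
          LaurentSeries ℚ) = ∑ A : Finset (Fin N),
      if Reduced K X A ∧ IsSpanOfFlat J (spanOf K X A) then t ^ (N - A.card) else 0 := by
    rw [map_sum]
    refine Finset.sum_congr rfl fun A _ => ?_
    split_ifs
    · rw [map_pow, t]
    · rw [map_zero]
  rw [hcoe, h, ← Finset.sum_filter]
  refine Finset.sum_congr ?_ fun A _ => ?_
  · ext A
    simp [chi_eq_one_iff, isSpanOfFlat_spanOf]
  · exact (t_pow_mul_pow (rank_le_rank_univ X A)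
      ((rank_le_card X _).trans (hcard _)) (rank_le_card X A) (hcard A)).symm

theorem aeval_tuttePolynomial (X : Fin N → U) (x y : LaurentSeries ℚ) :
    MvPolynomial.aeval ![x, y] (tuttePolynomial K X) = ∑ A : Finset (Fin N),
      (x - 1) ^ (rank (K := K) X Finset.univ - rank (K := K) X A) *
        (y - 1) ^ (A.card - rank (K := K) X A) := by
  simp [tuttePolynomial]

end Hilbert
end Zonotopal

/-! ### The theorem and its Tutte specializations. -/

open Zonotopal in
/-- Hilbert series of the semi-external spaces `P(X,0,J)`, and its specializations to the central
space (`J = {X}`) and to the external space (all flats), as identities of formal Laurent series.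
As `X` spans, `rank A ≤ r ≤ N`, and `rank A ≤ |A|`, so that no subtraction is truncated. -/
theorem mainTheorem4 {K : Type*} [Field K] [CharZero K]
    {V : Type*} [AddCommGroup V] [Module K V] [FiniteDimensional K V]
    (r : ℕ) (hr : Module.finrank K V = r) (hr1 : 1 ≤ r)
    (N : ℕ) (X : Fin N → Module.Dual K V) (hX : Submodule.span K (Set.range X) = ⊤) :
    (∀ J : UpperSet (Flat K X), (J : Set (Flat K X)).Nonempty →
      (hilbertSeries (PSpace 0 J) : LaurentSeries ℚ) =
        t ^ (N - r) * ∑ A : Finset (Fin N) with chi J A = 1,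
          t ^ (r - rank (K := K) X A) * (1 / t - 1) ^ (A.card - rank (K := K) X A)) ∧
    (hilbertSeries (PSpace 0 (UpperSet.Ici (topFlat K X))) : LaurentSeries ℚ) =
      t ^ (N - r) * MvPolynomial.aeval ![1, 1 / t] (tuttePolynomial K X) ∧
    -- `⊥ : UpperSet _` is the upper set of all flats
    (hilbertSeries (PSpace 0 (⊥ : UpperSet (Flat K X))) : LaurentSeries ℚ) =
      (hilbertSeries (PSpace 1 (UpperSet.Ici (topFlat K X))) : LaurentSeries ℚ) ∧
    (hilbertSeries (PSpace 1 (UpperSet.Ici (topFlat K X))) : LaurentSeries ℚ) =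
      t ^ (N - r) * MvPolynomial.aeval ![1 + t, 1 / t] (tuttePolynomial K X) := by
  have hrank : rank (K := K) X Finset.univ = r := by
    rw [rank, Set.finrank, Finset.coe_univ, Set.image_univ, hX, finrank_top,
      Subspace.dual_finrank_eq, hr]
  rw [← PSpace_bot_eq_external hX]
  refine ⟨fun J _ => ?_, ?_, rfl, ?_⟩
  · rw [coe_hilbertSeries_PSpace_zero, hrank]
  · rw [coe_hilbertSeries_PSpace_zero, hrank, aeval_tuttePolynomial, hrank, Finset.sum_filter]
    congr 1
    refine Finset.sum_congr rfl fun A _ => ?_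
    have hle := hrank ▸ rank_le_rank_univ (K := K) X A
    have hchi : chi (UpperSet.Ici (topFlat K X)) A = 1 ↔ rank (K := K) X A = r := by
      rw [chi_eq_one_iff, closFlat_mem_Ici_topFlat_iff, hrank]
    -- At x = 1 the factor 0^(r - rk A) is 1 for sets of full rank and 0 for all others.
    split_ifs with h
    · simp [hchi.1 h]
    · rw [hchi] at h
      rw [sub_self, zero_pow (by omega), zero_mul]
  · rw [coe_hilbertSeries_PSpace_zero, hrank, aeval_tuttePolynomial, hrank,
      Finset.filter_true_of_mem fun A _ => (chi_eq_one_iff ⊥ A).2 UpperSet.mem_bot]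
    simp
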